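/- Let $\Xi\subseteq\mathbb R^n$ be closed and convex, and let $\mathcal P(\Xi)$ be the set of Borel probability distributions on $\Xi$. Let $c:\Xi\times\Xi\to\mathbb R_+$ be lower semicontinuous with $c(\xi_1,\xi_2)=0$ if and only if $\xi_1=\xi_2$, and suppose that $c(\xi_1,\xi_2)\ge d(\xi_1,\xi_2)^p$ for all $\xi_1,\xi_2\in\Xi$, where $p\in\mathbb N$ and $d$ is a metric on $\Xi$ whose sublevel sets $\{\xi\in\Xi: d(\xi_0,\xi)\le r\}$ ($\xi_0\in\Xi$, $r\in\mathbb R$) are compact. For $\mathbb P,\mathbb Q\in\mathcal P(\Xi)$ let $C(\mathbb P,\mathbb Q)$ be the infimum of $\int_{\Xi^2} c\,\mathrm d\pi$ over all couplings $\pi$ of $\mathbb P$ and $\mathbb Q$. Let $K\ge 1$ and, for $k=1,\dots,K$, let $\widehat{\mathbb P}_k=\sum_{j=1}^{N_k}p_{k,j}\,\delta_{\widehat\xi_{k,j}}\in\mathcal P(\Xi)$ be a discrete distribution with $\widehat\xi_{k,j}\in\Xi$ and $p_{k,j}>0$. Let $\ell:\Xi\to\mathbb R$ be upper semicontinuous,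 and suppose that there are $\xi'\in\Xi$, $g'>0$ and $p'\in\mathbb N$ with $p'\le p$ such that $\ell(\xi)\le g'(1+d(\xi,\xi')^{p'})$ for all $\xi\in\Xi$. For $\varepsilon\in\mathbb R_+^K$ consider the primal problem $$\sup\Big\{\int_\Xi \ell\,\mathrm d\mathbb P\ :\ \mathbb P\in\mathcal P(\Xi),\ C(\mathbb P,\widehat{\mathbb P}_k)\le\varepsilon_k\ \text{ for } k=1,\dots,K\Big\}$$ and the problem $$\begin{array}{cl}\inf & \displaystyle\sum_{k=1}^K\varepsilon_k\lambda_k+\sum_{k=1}^K\sum_{j=1}^{N_k}p_{k,j}\gamma_{k,j}\\ \text{s.t.} & \lambda_k\in\mathbb R_+,\ \gamma_k\in\mathbb R^{N_k}\quad (k=1,\dots,K),\\ & \displaystyle\sup_{\xi\in\Xi}\Big(\ell(\xi)-\sum_{k=1}^K\lambda_k c(\xi,\widehat\xi_{k,\alpha_k})\Big)\le\sum_{k=1}^K\gamma_{k,\alpha_k}\quad\text{for all }\alpha\in\{1,\dots,N_1\}\times\cdots\times\{1,\dots,N_K\},\end{array}$$ where optimal values lie in $[-\infty,\infty]$, with $\sup\emptyset=-\infty$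 and $\inf\emptyset=+\infty$, and $\int_\Xi\ell\,\mathrm d\mathbb P=-\infty$ if the negative part of $\ell$ is not integrable (its positive part is integrable for every feasible $\mathbb P$). Let $\mathcal E\subseteq\mathbb R_+^K$ be the set of all $\varepsilon$ for which the primal problem is feasible. Then the second problem is a dual of the primal problem: for every $\varepsilon\in\mathbb R_+^K$ the optimal value of the primal problem is at most that of the second problem. Moreover, strong duality holds, that is, the two optimal values are equal, for every $\varepsilon\in\mathbb R_+^K$ outside the boundary $\partial\mathcal E$ of $\mathcal E$ relative to $\mathbb R_+^K$ (hence also for every $\varepsilon\in\mathbb R_+^K$ outside the boundary of $\mathcal E$ in $\mathbb R^K$). -/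

import Mathlib

open MeasureTheory
open scoped NNReal ENNReal

/-- `ρ` is a metric on `X` (nonnegativity follows from the three laws). It is a plain function, so
that `X` keeps the topology it already has. -/
structure IsMetricFun {X : Type*} (ρ : X → X → ℝ) : Prop where
  eq_zero_iff : ∀ x y, ρ x y = 0 ↔ x = y
  symm : ∀ x y, ρ x y = ρ y x
  triangle : ∀ x y z, ρ x z ≤ ρ x y + ρ y z

/-- The assumption on the transportation cost `c`: it is nonnegative, jointly lower semicontinuous,
vanishes exactly on the diagonal, and dominates `ρ ^ p` for a metric `ρ` with compact sublevel
sets. -/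
structure IsTransportCost {X : Type*} [TopologicalSpace X] (c ρ : X → X → ℝ) (p : ℕ) : Prop where
  nonneg : ∀ x y, 0 ≤ c x y
  lsc : LowerSemicontinuous fun z : X × X => c z.1 z.2
  eq_zero_iff : ∀ x y, c x y = 0 ↔ x = y
  metric : IsMetricFun ρ
  compact_sublevel : ∀ (x : X) (r : ℝ), IsCompact {y | ρ x y ≤ r}
  lower_bound : ∀ x y, ρ x y ^ p ≤ c x y

/-- The loss grows at most like the `p'`-th power of the metric `ρ`. -/
def HasGrowth {X : Type*} (ρ : X → X → ℝ) (loss : X → ℝ) (p' : ℕ) : Prop :=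
  ∃ (x' : X) (g' : ℝ), 0 < g' ∧ ∀ x, loss x ≤ g' * (1 + ρ x x' ^ p')

/-- The transportation plans (couplings) of `P` and `Q`. -/
def transportPlans {X : Type*} [MeasurableSpace X] (P Q : ProbabilityMeasure X) :
    Set (ProbabilityMeasure (X × X)) :=
  {π | (π : Measure (X × X)).map Prod.fst = (P : Measure X) ∧
    (π : Measure (X × X)).map Prod.snd = (Q : Measure X)}

/-- The optimal transport cost `C(P, Q)` induced by the nonnegative cost function `c`. -/
noncomputable def otCost {X : Type*} [MeasurableSpace X] (c : X → X → ℝ)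
    (P Q : ProbabilityMeasure X) : ℝ≥0∞ :=
  ⨅ π ∈ transportPlans P Q, ∫⁻ z, ENNReal.ofReal (c z.1 z.2) ∂(π : Measure (X × X))

/-- The ball `{P | C(P, Q) ≤ r}`. -/
def otBall {X : Type*} [MeasurableSpace X] (c : X → X → ℝ)
    (Q : ProbabilityMeasure X) (r : ℝ≥0) : Set (ProbabilityMeasure X) :=
  {P | otCost c P Q ≤ (r : ℝ≥0∞)}

/-- The intersection of the `K` balls around the reference distributions. -/
def ambiguitySet {X : Type*} [MeasurableSpace X] (c : X → X → ℝ) {K : ℕ}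
    (Q : Fin K → ProbabilityMeasure X) (ε : Fin K → ℝ≥0) : Set (ProbabilityMeasure X) :=
  ⋂ k, otBall c (Q k) (ε k)

/-- The set of all radius vectors in the nonnegative orthant for which the ambiguity set is
nonempty. -/
def feasibleRadii {X : Type*} [MeasurableSpace X] (c : X → X → ℝ) {K : ℕ}
    (Q : Fin K → ProbabilityMeasure X) : Set (Fin K → ℝ≥0) :=
  {ε | (ambiguitySet c Q ε).Nonempty}

/-- The expectation of `f` under `P` with values in `[-∞, ∞]`, the difference of the integrals of
the positive and the negative part (with the convention `∞ - ∞ = -∞`). -/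
noncomputable def expectation {X : Type*} [MeasurableSpace X] (P : ProbabilityMeasure X)
    (f : X → ℝ) : EReal :=
  ((∫⁻ x, ENNReal.ofReal (f x) ∂(P : Measure X) : ℝ≥0∞) : EReal) -
    ((∫⁻ x, ENNReal.ofReal (-f x) ∂(P : Measure X) : ℝ≥0∞) : EReal)

/-- The worst-case expected loss over the ambiguity set, `-∞` if that set is empty. -/
noncomputable def primalValue {X : Type*} [MeasurableSpace X] (c : X → X → ℝ) (loss : X → ℝ)
    {K : ℕ} (Q : Fin K → ProbabilityMeasure X) (ε : Fin K → ℝ≥0) : EReal :=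
  ⨆ P ∈ ambiguitySet c Q ε, expectation P loss

/-- The feasible set of the dual problem in the variables `(lam, γ)`. -/
def dualFeasible {X : Type*} (c : X → X → ℝ) (loss : X → ℝ) {K : ℕ} {N : Fin K → ℕ}
    (atom : ∀ k, Fin (N k) → X) : Set ((Fin K → ℝ) × (∀ k, Fin (N k) → ℝ)) :=
  {v | (∀ k, 0 ≤ v.1 k) ∧
    ∀ α : ∀ k, Fin (N k),
      (⨆ x : X, ((loss x - ∑ k, v.1 k * c x (atom k (α k)) : ℝ) : EReal)) ≤
        ((∑ k, v.2 k (α k) : ℝ) : EReal)}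

/-- The optimal value of the dual problem. -/
noncomputable def dualValue {X : Type*} (c : X → X → ℝ) (loss : X → ℝ) {K : ℕ} {N : Fin K → ℕ}
    (prob : ∀ k, Fin (N k) → ℝ) (atom : ∀ k, Fin (N k) → X) (ε : Fin K → ℝ≥0) : EReal :=
  ⨅ v ∈ dualFeasible c loss atom,
    ((∑ k, (ε k : ℝ) * v.1 k + ∑ k, ∑ j, prob k j * v.2 k j : ℝ) : EReal)

/-! ### Weak duality: integrating a dual certificate along transport plans. -/

section WeakDuality

variable {X : Type*} [MeasurableSpace X]

/-! Weak duality: a dual point yields functions `h k x = min_j (λ_k c(x, ξ_kj) + γ_kj)`. The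
constraints over all `α` say exactly that `loss ≤ ∑ k, h k`, and integrating `h k` along a nearly
optimal plan to `Q k` gives at most `ε_k λ_k + ∑ j, p_kj γ_kj`.

The reverse inequality is conic linear programming over finitely supported plans on pairs `(x, α)`,
where mass at `x` is sent to atom `α k` of `Q k` for all `k` simultaneously. If `v` is below the
dual value, Hahn–Banach puts `(prob, ε, v)` in the closure of `planCone` (`mem_closure_planCone`).
This needs a dual feasible point, which the growth bound and the compact sublevel sets supply.
Repairing the marginals (`exists_plan_of_mem_closure`) leaves plans with exact marginals, costs at
most `ε k + δ` and value at least `v - δ`.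

The excess `δ` is handled in three cases. Outside the closure of the feasible radii such plans
cannot exist for every `δ`, so the dual value is `⊥`. In the interior with positive radii, mixing in
a strictly feasible plan absorbs `δ`. If some radius is zero, no such plan need exist; but then the
ball is `{Q k}`, and `λ_k` costs nothing in the dual, so a large `λ_k` brings the dual value down to
the expected loss under `Q k`. -/

theorem expectation_eq_integral (P : ProbabilityMeasure X) {f : X → ℝ}
    (hf : Integrable f (P : Measure X)) :
    expectation P f = ((∫ x, f x ∂(P : Measure X) : ℝ) : EReal) := by
  have h1 : ∫⁻ x, ENNReal.ofReal (f x) ∂(P : Measure X) ≠ ⊤ :=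
    (hf.lintegral_lt_top).ne
  have h2 : ∫⁻ x, ENNReal.ofReal (-f x) ∂(P : Measure X) ≠ ⊤ :=
    (hf.neg.lintegral_lt_top).ne
  rw [integral_eq_lintegral_pos_part_sub_lintegral_neg_part hf, expectation, EReal.coe_sub,
    EReal.coe_ennreal_toReal h1, EReal.coe_ennreal_toReal h2]

theorem expectation_le_integral (P : ProbabilityMeasure X) {f h : X → ℝ} (hf : Measurable f)
    (hh : Integrable h (P : Measure X)) (hle : ∀ x, f x ≤ h x) :
    expectation P f ≤ ((∫ x, h x ∂(P : Measure X) : ℝ) : EReal) := by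
  by_cases htop : ∫⁻ x, ENNReal.ofReal (-f x) ∂(P : Measure X) = ⊤
  · simp [expectation, htop]
  have hint : Integrable f (P : Measure X) := by
    refine ⟨hf.aestronglyMeasurable, ?_⟩
    have hbound : ∀ x, ‖f x‖ₑ ≤ ENNReal.ofReal (-f x) + ‖h x‖ₑ := by
      intro x
      rw [← ofReal_norm, ← ofReal_norm, Real.norm_eq_abs, Real.norm_eq_abs]
      rcases le_total 0 (f x) with h0 | h0
      · exact le_add_left (ENNReal.ofReal_le_ofReal
          (by rw [abs_of_nonneg h0]; exact (hle x).trans (le_abs_self _)))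
      · exact le_add_right (ENNReal.ofReal_le_ofReal (by rw [abs_of_nonpos h0]))
    calc ∫⁻ x, ‖f x‖ₑ ∂(P : Measure X)
        ≤ ∫⁻ x, (ENNReal.ofReal (-f x) + ‖h x‖ₑ) ∂(P : Measure X) := lintegral_mono hbound
      _ = ∫⁻ x, ENNReal.ofReal (-f x) ∂(P : Measure X) + ∫⁻ x, ‖h x‖ₑ ∂(P : Measure X) :=
          lintegral_add_left (by fun_prop) _
      _ < ⊤ := ENNReal.add_lt_top.2 ⟨lt_top_iff_ne_top.2 htop, hh.2⟩
  rw [expectation_eq_integral P hint]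
  exact EReal.coe_le_coe_iff.2 (integral_mono hint hh hle)

theorem sum_eq_one_of_discrete {m : ℕ} (Q : ProbabilityMeasure X) {w : Fin m → ℝ} {a : Fin m → X}
    (hw : ∀ j, 0 ≤ w j)
    (hQ : (Q : Measure X) = ∑ j, ENNReal.ofReal (w j) • Measure.dirac (a j)) :
    ∑ j, w j = 1 := by
  have h := measure_univ (μ := (Q : Measure X))
  rw [hQ] at h
  simp only [Measure.coe_finsetSum, Finset.sum_apply, Measure.smul_apply, measure_univ,
    smul_eq_mul, mul_one] at h
  rw [← ENNReal.ofReal_sum_of_nonneg fun j _ => hw j] at h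
  exact ENNReal.ofReal_eq_one.1 h

theorem integral_discrete [MeasurableSingletonClass X] {m : ℕ} (Q : ProbabilityMeasure X)
    {w : Fin m → ℝ} {a : Fin m → X} (hw : ∀ j, 0 ≤ w j)
    (hQ : (Q : Measure X) = ∑ j, ENNReal.ofReal (w j) • Measure.dirac (a j)) (f : X → ℝ) :
    Integrable f (Q : Measure X) ∧ ∫ x, f x ∂(Q : Measure X) = ∑ j, w j * f (a j) := by
  have hi : ∀ j ∈ Finset.univ,
      Integrable f (ENNReal.ofReal (w j) • Measure.dirac (a j)) := fun j _ =>
    (integrable_dirac (by simp)).smul_measure ENNReal.ofReal_ne_top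
  rw [hQ]
  refine ⟨integrable_finsetSum_measure.2 hi, ?_⟩
  rw [integral_finsetSum_measure hi]
  refine Finset.sum_congr rfl fun j _ => ?_
  rw [integral_smul_measure, integral_dirac, ENNReal.toReal_ofReal (hw j), smul_eq_mul]

/-- A function that is dominated by `lam * c (·, a j) + γ j` for each atom `a j` of `Q` has
expectation at most `lam * r + ∑ j, w j * γ j` under each `P` in the ball of radius `r`. -/
theorem integral_le_of_mem_otBall [MeasurableSingletonClass X] {c : X → X → ℝ}
    (hc0 : ∀ x y, 0 ≤ c x y) (hcm : Measurable fun z : X × X => c z.1 z.2)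
    {m : ℕ} {P Q : ProbabilityMeasure X} {w : Fin m → ℝ} {a : Fin m → X} (hw : ∀ j, 0 ≤ w j)
    (hQ : (Q : Measure X) = ∑ j, ENNReal.ofReal (w j) • Measure.dirac (a j))
    {r : ℝ≥0} (hP : P ∈ otBall c Q r) {lam : ℝ} (hlam : 0 ≤ lam) {γ : Fin m → ℝ} {h : X → ℝ}
    (hm : Measurable h) {b : ℝ} (hb : ∀ x, b ≤ h x) (hle : ∀ x j, h x ≤ lam * c x (a j) + γ j) :
    Integrable h (P : Measure X) ∧
      ∫ x, h x ∂(P : Measure X) ≤ r * lam + ∑ j, w j * γ j := by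
  classical
  -- The slack `δ` replaces the existence of an optimal plan.
  have key : ∀ δ : ℝ, 0 < δ → Integrable h (P : Measure X) ∧
      ∫ x, h x ∂(P : Measure X) ≤ (r + δ) * lam + ∑ j, w j * γ j := by
    intro δ hδ
    have hlt : otCost c P Q < (r : ℝ≥0∞) + ENNReal.ofReal δ :=
      lt_of_le_of_lt hP (ENNReal.lt_add_right ENNReal.coe_ne_top (by simpa using hδ))
    obtain ⟨π, hπ, hπc⟩ : ∃ π ∈ transportPlans P Q,
        ∫⁻ z, ENNReal.ofReal (c z.1 z.2) ∂(π : Measure (X × X)) <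
          (r : ℝ≥0∞) + ENNReal.ofReal δ := by
      simpa only [otCost, iInf_lt_iff, exists_prop] using hlt
    obtain ⟨h1, h2⟩ := hπ
    have hci : Integrable (fun z : X × X => c z.1 z.2) (π : Measure (X × X)) := by
      refine (lintegral_ofReal_ne_top_iff_integrable hcm.aestronglyMeasurable
        (Filter.Eventually.of_forall fun z => hc0 _ _)).1 ?_
      exact (hπc.trans (by simp)).ne
    have hcint : ∫ z, c z.1 z.2 ∂(π : Measure (X × X)) ≤ r + δ := by
      rw [integral_eq_lintegral_of_nonneg_ae (Filter.Eventually.of_forall fun z => hc0 _ _)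
        hcm.aestronglyMeasurable]
      refine ENNReal.toReal_le_of_le_ofReal (by positivity) ?_
      rw [ENNReal.ofReal_add r.coe_nonneg hδ.le, ENNReal.ofReal_coe_nnreal]
      exact hπc.le
    -- Atoms may coincide, so `γ` need not be a function of the location; `g` takes the least `γ j`
    -- among the indices sharing an atom.
    obtain ⟨g, hgm, hg, hgle⟩ : ∃ g : X → ℝ, Measurable g ∧
        (∀ x j, h x ≤ lam * c x (a j) + g (a j)) ∧ ∀ j, g (a j) ≤ γ j := by
      let m0 : X → ℝ := fun y => ⨅ j : {j // a j = y}, γ j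
      refine ⟨fun y => ∑ z ∈ Finset.univ.image a, Set.indicator {z} (fun _ => m0 z) y, ?_, ?_, ?_⟩
      · exact Finset.measurable_sum _ fun z _ =>
          measurable_const.indicator (measurableSet_singleton z)
      all_goals
        have hval : ∀ j, ∑ z ∈ Finset.univ.image a,
            Set.indicator {z} (fun _ => m0 z) (a j) = m0 (a j) := by
          intro j
          rw [Finset.sum_eq_single (a j)]
          · simp
          · intro z _ hz
            exact Set.indicator_of_notMem (by simpa using hz.symm) _
          · intro hn
            exact absurd (Finset.mem_image_of_mem a (Finset.mem_univ j)) hn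
      · intro x j
        simp only [hval]
        have : Nonempty {i // a i = a j} := ⟨⟨j, rfl⟩⟩
        have : h x - lam * c x (a j) ≤ m0 (a j) := by
          refine le_ciInf fun i => ?_
          have := hle x i
          rw [i.2] at this
          linarith
        linarith
      · intro j
        simp only [hval]
        exact ciInf_le (Set.finite_range (fun i : {i // a i = a j} => γ i)).bddBelow ⟨j, rfl⟩
    obtain ⟨hgi, hgint⟩ := integral_discrete Q hw hQ g
    have hgi' : Integrable (fun z : X × X => g z.2) (π : Measure (X × X)) := by
      rw [← h2] at hgi
      exact hgi.comp_measurable measurable_snd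
    have hgint' : ∫ z, g z.2 ∂(π : Measure (X × X)) = ∑ j, w j * g (a j) := by
      rw [← hgint, ← h2, integral_map measurable_snd.aemeasurable hgm.aestronglyMeasurable]
    have hae : ∀ᵐ z ∂(π : Measure (X × X)), h z.1 ≤ lam * c z.1 z.2 + g z.2 := by
      have hQae : ∀ᵐ y ∂(Q : Measure X), ∃ j, a j = y := by
        have hfin : MeasurableSet (Set.range a)ᶜ := (Set.finite_range a).measurableSet.compl
        rw [hQ, ae_iff]
        change (_ : Measure X) (Set.range a)ᶜ = 0
        simp [hfin]
      rw [← h2] at hQae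
      filter_upwards [ae_of_ae_map measurable_snd.aemeasurable hQae] with z hz
      obtain ⟨j, hj⟩ := hz
      rw [← hj]
      exact hg z.1 j
    have hub : Integrable (fun z : X × X => lam * c z.1 z.2 + g z.2) (π : Measure (X × X)) :=
      (hci.const_mul lam).add hgi'
    have hhi : Integrable (fun z : X × X => h z.1) (π : Measure (X × X)) :=
      integrable_of_le_of_le (hm.comp measurable_fst).aestronglyMeasurable
        (Filter.Eventually.of_forall fun z => hb z.1) hae (integrable_const b) hub
    rw [← h1]
    refine ⟨(integrable_map_measure hm.aestronglyMeasurable measurable_fst.aemeasurable).2 hhi, ?_⟩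
    rw [integral_map measurable_fst.aemeasurable hm.aestronglyMeasurable]
    calc ∫ z, h z.1 ∂(π : Measure (X × X))
        ≤ ∫ z, (lam * c z.1 z.2 + g z.2) ∂(π : Measure (X × X)) := integral_mono_ae hhi hub hae
      _ = lam * ∫ z, c z.1 z.2 ∂(π : Measure (X × X)) + ∑ j, w j * g (a j) := by
          rw [integral_add (hci.const_mul lam) hgi', integral_const_mul, hgint']
      _ ≤ lam * (r + δ) + ∑ j, w j * γ j := by
          gcongr with j
          · exact hw j
          · exact hgle j
      _ = (r + δ) * lam + ∑ j, w j * γ j := by ring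
  refine ⟨(key 1 one_pos).1, le_of_forall_pos_le_add fun e he => ?_⟩
  have h1 := (key (e / (lam + 1)) (by positivity)).2
  have h2 : e / (lam + 1) * lam ≤ e := by
    rw [div_mul_eq_mul_div, div_le_iff₀ (by positivity)]
    nlinarith
  linarith

theorem primalValue_le_dualValue [MeasurableSingletonClass X] {c : X → X → ℝ}
    (hc0 : ∀ x y, 0 ≤ c x y) (hcm : Measurable fun z : X × X => c z.1 z.2)
    {K : ℕ} {Q : Fin K → ProbabilityMeasure X} {N : Fin K → ℕ} {prob : ∀ k, Fin (N k) → ℝ}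
    {atom : ∀ k, Fin (N k) → X} (hprob : ∀ k j, 0 ≤ prob k j)
    (hQ : ∀ k, (Q k : Measure X) =
      ∑ j, ENNReal.ofReal (prob k j) • Measure.dirac (atom k j))
    {loss : X → ℝ} (hloss : Measurable loss) (ε : Fin K → ℝ≥0) :
    primalValue c loss Q ε ≤ dualValue c loss prob atom ε := by
  refine iSup₂_le fun P hP => le_iInf₂ fun v hv => ?_
  obtain ⟨hlam, hv⟩ := hv
  have : ∀ k, Nonempty (Fin (N k)) := by
    intro k
    by_contra hne
    rw [not_nonempty_iff] at hne
    have := sum_eq_one_of_discrete (Q k) (hprob k) (hQ k)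
    simp at this
  let h : Fin K → X → ℝ := fun k x => ⨅ j, (v.1 k * c x (atom k j) + v.2 k j)
  have hle : ∀ k x j, h k x ≤ v.1 k * c x (atom k j) + v.2 k j := fun k x j =>
    ciInf_le (Set.finite_range _).bddBelow j
  have hm : ∀ k, Measurable (h k) := fun k => Measurable.iInf fun j =>
    ((hcm.comp (measurable_id.prodMk measurable_const)).const_mul _).add_const _
  have hb : ∀ k x, ⨅ j, v.2 k j ≤ h k x := by
    intro k x
    refine le_ciInf fun j => (ciInf_le (Set.finite_range (v.2 k)).bddBelow j).trans ?_
    have := mul_nonneg (hlam k) (hc0 x (atom k j))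
    linarith
  have hk : ∀ k, Integrable (h k) (P : Measure X) ∧
      ∫ x, h k x ∂(P : Measure X) ≤ ε k * v.1 k + ∑ j, prob k j * v.2 k j := fun k =>
    integral_le_of_mem_otBall hc0 hcm (hprob k) (hQ k) (Set.mem_iInter.1 hP k) (hlam k)
      (hm k) (hb k) (hle k)
  -- At a fixed `x`, the constraint is used for the multi-index `α` of the minimizers.
  have hdom : ∀ x, loss x ≤ ∑ k, h k x := by
    intro x
    choose α hα using fun k =>
      exists_eq_ciInf_of_finite (f := fun j => v.1 k * c x (atom k j) + v.2 k j)
    have h1 := EReal.coe_le_coe_iff.1 ((le_iSup _ x).trans (hv α))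
    have h2 : ∑ k, h k x = ∑ k, (v.1 k * c x (atom k (α k)) + v.2 k (α k)) :=
      Finset.sum_congr rfl fun k _ => (hα k).symm
    rw [h2, Finset.sum_add_distrib]
    linarith
  refine (expectation_le_integral P hloss (integrable_finsetSum _ fun k _ => (hk k).1) hdom).trans
    (EReal.coe_le_coe_iff.2 ?_)
  rw [integral_finsetSum _ fun k _ => (hk k).1, ← Finset.sum_add_distrib]
  exact Finset.sum_le_sum fun k _ => (hk k).2

end WeakDuality

/-! ### Penalization by large multipliers, and balls of radius zero. -/

section Domination

open Filter Topology

variable {X : Type*}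

theorem IsMetricFun.nonneg {ρ : X → X → ℝ} (hρ : IsMetricFun ρ) (x y : X) : 0 ≤ ρ x y := by
  have h1 := hρ.triangle x y x
  rw [(hρ.eq_zero_iff x x).2 rfl, hρ.symm y x] at h1
  linarith

theorem HasGrowth.exists_le_pow {ρ : X → X → ℝ} (hρ : IsMetricFun ρ) {loss : X → ℝ} {p p' : ℕ}
    (h : HasGrowth ρ loss p') (hp : p' ≤ p) (a : X) :
    ∃ B : ℝ, ∀ x, 1 ≤ ρ x a → loss x ≤ B * ρ x a ^ p := by
  obtain ⟨x', g, hg, h⟩ := h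
  have hD : 0 ≤ ρ a x' := hρ.nonneg a x'
  refine ⟨g * (1 + (1 + ρ a x') ^ p'), fun x hx => ?_⟩
  have h0 := hρ.nonneg x x'
  have h1 : ρ x x' ≤ (1 + ρ a x') * ρ x a := by
    have := hρ.triangle x a x'
    nlinarith
  have h2 : ρ x x' ^ p' ≤ (1 + ρ a x') ^ p' * ρ x a ^ p := by
    calc ρ x x' ^ p' ≤ ((1 + ρ a x') * ρ x a) ^ p' := pow_le_pow_left₀ h0 h1 _
      _ = (1 + ρ a x') ^ p' * ρ x a ^ p' := mul_pow _ _ _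
      _ ≤ (1 + ρ a x') ^ p' * ρ x a ^ p := by gcongr
  have h3 : 1 ≤ ρ x a ^ p := one_le_pow₀ hx
  calc loss x ≤ g * (1 + ρ x x' ^ p') := h x
    _ ≤ g * (ρ x a ^ p + (1 + ρ a x') ^ p' * ρ x a ^ p) := by gcongr
    _ = g * (1 + (1 + ρ a x') ^ p') * ρ x a ^ p := by ring

/-- The dual point vanishes in all blocks except the `k`-th. -/
theorem dualValue_le_of_penalized_le {c : X → X → ℝ} {loss : X → ℝ} {K : ℕ} {N : Fin K → ℕ}
    {prob : ∀ k, Fin (N k) → ℝ} {atom : ∀ k, Fin (N k) → X} (k : Fin K) {L : ℝ} (hL : 0 ≤ L)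
    {γ : Fin (N k) → ℝ} (h : ∀ j x, loss x ≤ L * c x (atom k j) + γ j) (ε : Fin K → ℝ≥0) :
    dualValue c loss prob atom ε ≤ ((ε k * L + ∑ j, prob k j * γ j : ℝ) : EReal) := by
  classical
  have hmem : ((Pi.single k L, Pi.single k γ) : (Fin K → ℝ) × (∀ k, Fin (N k) → ℝ)) ∈
      dualFeasible c loss atom := by
    refine ⟨fun i => ?_, fun α => iSup_le fun x => EReal.coe_le_coe_iff.2 ?_⟩
    · by_cases hi : i = k
      · subst hi
        simpa using hL
      · simp [hi]
    · rw [Finset.sum_eq_single k (by intro i _ hi; simp [hi]) (by simp),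
        Finset.sum_eq_single k (by intro i _ hi; simp [hi]) (by simp)]
      have := h (α k) x
      simp only [Pi.single_eq_same]
      linarith
  refine (iInf₂_le _ hmem).trans_eq (congrArg _ ?_)
  rw [Finset.sum_eq_single k (by intro i _ hi; simp [hi]) (by simp),
    Finset.sum_eq_single k (by intro i _ hi; simp [hi]) (by simp)]
  simp only [Pi.single_eq_same]

variable [TopologicalSpace X]

/-- For large multipliers, the penalized loss `loss - L * c (·, a)` is almost maximal at `a`. -/
theorem IsTransportCost.eventually_penalized_le {c ρ : X → X → ℝ} {p p' : ℕ}
    (hc : IsTransportCost c ρ p) {loss : X → ℝ} (hloss : UpperSemicontinuous loss)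
    (hgrowth : HasGrowth ρ loss p') (hp : p' ≤ p) (a : X) {η : ℝ} (hη : 0 < η) :
    ∀ᶠ L : ℝ in atTop, ∀ x, loss x ≤ L * c x a + (loss a + η) := by
  obtain ⟨B, hB⟩ := hgrowth.exists_le_pow hc.metric hp a
  have hlsc : LowerSemicontinuous fun x => c x a :=
    hc.lsc.comp (continuous_id.prodMk continuous_const)
  -- Near `a` semicontinuity of the loss suffices; near any other point `c` is bounded away from
  -- zero, so a large `L` wins. Compactness makes the threshold uniform on the unit ball, and the
  -- growth bound covers the rest.
  have hloc : ∀ x, ∃ t ∈ 𝓝 x, ∀ᶠ L : ℝ in atTop, ∀ y ∈ t, loss y ≤ L * c y a + (loss a + η) := by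
    intro x
    by_cases hxa : x = a
    · subst hxa
      refine ⟨{y | loss y < loss x + η}, hloss x _ (by linarith), ?_⟩
      filter_upwards [eventually_ge_atTop 0] with L hL y hy
      have := mul_nonneg hL (hc.nonneg y x)
      have hy' : loss y < loss x + η := hy
      linarith
    · have hpos : 0 < c x a :=
        lt_of_le_of_ne (hc.nonneg x a) fun h => hxa ((hc.eq_zero_iff x a).1 h.symm)
      refine ⟨{y | loss y < loss x + 1} ∩ {y | c x a / 2 < c y a},
        inter_mem (hloss x _ (by linarith)) (hlsc x _ (by linarith)), ?_⟩
      filter_upwards [eventually_ge_atTop 0,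
        eventually_ge_atTop ((loss x + 1 - (loss a + η)) / (c x a / 2))] with L hL hL' y hy
      rw [div_le_iff₀ (by positivity)] at hL'
      have h1 : loss y < loss x + 1 := hy.1
      have h2 : c x a / 2 < c y a := hy.2
      have h3 := mul_le_mul_of_nonneg_left h2.le hL
      linarith
  choose t ht hev using hloc
  obtain ⟨s, -, hs⟩ := (hc.compact_sublevel a 1).elim_nhds_subcover t fun x _ => ht x
  filter_upwards [(eventually_all_finset s).2 fun x _ => hev x, eventually_ge_atTop B,
    eventually_ge_atTop (B - loss a), eventually_ge_atTop 0] with L hL hLB hLB' hL0 x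
  by_cases hx : ρ a x ≤ 1
  · obtain ⟨z, hz, hxz⟩ := Set.mem_iUnion₂.1 (hs hx)
    exact hL z hz x hxz
  · have hx1 : 1 ≤ ρ x a := by
      rw [hc.metric.symm]
      exact (not_le.1 hx).le
    have h1 := hB x hx1
    have h2 : (1 : ℝ) ≤ ρ x a ^ p := one_le_pow₀ hx1
    have h3 := hc.lower_bound x a
    have h4 : B * ρ x a ^ p - L * c x a ≤ B - L := by
      nlinarith [mul_le_mul_of_nonneg_left h3 hL0, mul_le_mul_of_nonneg_left h2 (sub_nonneg.2 hLB)]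
    linarith

variable {c ρ : X → X → ℝ} {p p' : ℕ} {loss : X → ℝ} {K : ℕ} {N : Fin K → ℕ}
  {prob : ∀ k, Fin (N k) → ℝ} {atom : ∀ k, Fin (N k) → X}

theorem IsTransportCost.exists_penalized_le (hc : IsTransportCost c ρ p)
    (hloss : UpperSemicontinuous loss) (hgrowth : HasGrowth ρ loss p') (hp : p' ≤ p)
    {m : ℕ} (a : Fin m → X) {η : ℝ} (hη : 0 < η) :
    ∃ L : ℝ, 0 ≤ L ∧ ∀ j x, loss x ≤ L * c x (a j) + (loss (a j) + η) :=
  ((eventually_ge_atTop 0).and (eventually_all.2 fun j =>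
    hc.eventually_penalized_le hloss hgrowth hp (a j) hη)).exists

/-- If one radius vanishes, the dual value is at most the expected loss of the corresponding
reference distribution. -/
theorem IsTransportCost.dualValue_le_sum (hc : IsTransportCost c ρ p)
    (hloss : UpperSemicontinuous loss) (hgrowth : HasGrowth ρ loss p') (hp : p' ≤ p)
    {k : Fin K} (hprob : ∑ j, prob k j = 1) {ε : Fin K → ℝ≥0} (hε : ε k = 0) :
    dualValue c loss prob atom ε ≤ ((∑ j, prob k j * loss (atom k j) : ℝ) : EReal) := by
  -- The gap up to `z` serves as `η`; the multiplier `L` it requires is free because `ε k = 0`.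
  refine EReal.le_of_forall_lt_iff_le.1 fun z hz => ?_
  have hη : 0 < z - ∑ j, prob k j * loss (atom k j) := sub_pos.2 (EReal.coe_lt_coe_iff.1 hz)
  obtain ⟨L, hL, h⟩ := hc.exists_penalized_le hloss hgrowth hp (atom k) hη
  refine (dualValue_le_of_penalized_le k hL h ε).trans_eq ?_
  simp only [hε, mul_add, Finset.sum_add_distrib, ← Finset.sum_mul, hprob]
  congr 1
  simp

/-- Weak duality for a single ball of radius zero, with a bounded continuous `f` as loss, gives `∫ f
dP ≤ ∫ f dQ`; using `-f` as well determines `P`. No optimal plan is needed. -/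
theorem eq_of_mem_otBall_zero [MeasurableSpace X] [BorelSpace X] [MeasurableSingletonClass X]
    [HasOuterApproxClosed X] (hc : IsTransportCost c ρ p)
    (hcm : Measurable fun z : X × X => c z.1 z.2) {m : ℕ} {w : Fin m → ℝ} {a : Fin m → X}
    (hw : ∀ j, 0 ≤ w j) {P Q : ProbabilityMeasure X}
    (hQ : (Q : Measure X) = ∑ j, ENNReal.ofReal (w j) • Measure.dirac (a j))
    (hP : P ∈ otBall c Q 0) : P = Q := by
  have key : ∀ f : BoundedContinuousFunction X ℝ,
      ∫ x, f x ∂(P : Measure X) ≤ ∫ x, f x ∂(Q : Measure X) := by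
    intro f
    have hint : Integrable f (P : Measure X) := f.integrable _
    have hne := (P : Measure X).nonempty_of_neZero
    have hgrowth : HasGrowth ρ f 0 := by
      refine ⟨hne.some, ‖f‖ + 1, by positivity, fun x => ?_⟩
      have := (le_abs_self _).trans (f.norm_coe_le_norm x)
      have h0 := norm_nonneg f
      simp only [pow_zero]
      linarith
    have h1 : expectation P f ≤ primalValue c f (fun _ : Fin 1 => Q) (fun _ => 0) :=
      le_iSup₂_of_le P (Set.mem_iInter.2 fun _ => hP) le_rfl
    have h2 := primalValue_le_dualValue hc.nonneg hcm (Q := fun _ : Fin 1 => Q)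
      (N := fun _ => m) (prob := fun _ => w) (atom := fun _ => a) (fun _ => hw) (fun _ => hQ)
      f.continuous.measurable (fun _ => 0)
    have h3 := hc.dualValue_le_sum (N := fun _ : Fin 1 => m) (prob := fun _ => w)
      (atom := fun _ => a) f.continuous.upperSemicontinuous hgrowth (Nat.zero_le p) (k := 0)
      (sum_eq_one_of_discrete Q hw hQ) (ε := fun _ => 0) rfl
    have h4 := h1.trans (h2.trans h3)
    rw [expectation_eq_integral P hint, EReal.coe_le_coe_iff] at h4
    rwa [(integral_discrete Q hw hQ f).2]
  have heq : (P : Measure X) = (Q : Measure X) := by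
    refine ext_of_forall_integral_eq_of_IsFiniteMeasure fun f => le_antisymm (key f) ?_
    have := key (-f)
    simp only [BoundedContinuousFunction.coe_neg, Pi.neg_apply, integral_neg] at this
    linarith
  exact Subtype.ext heq

end Domination

/-! ### The cone of finitely supported plans and its separation from a point. -/

section Plans

/-- The integral of `f` under the finitely supported signed measure `μ`, as a linear map in `μ`. -/
noncomputable def planSum {Z : Type*} (f : Z → ℝ) : (Z →₀ ℝ) →ₗ[ℝ] ℝ :=
  Finsupp.linearCombination ℝ f

theorem planSum_apply {Z : Type*} (f : Z → ℝ) (μ : Z →₀ ℝ) :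
    planSum f μ = ∑ z ∈ μ.support, μ z * f z := by
  simp [planSum, Finsupp.linearCombination_apply, Finsupp.sum]

@[simp]
theorem planSum_single {Z : Type*} (f : Z → ℝ) (z : Z) (s : ℝ) :
    planSum f (Finsupp.single z s) = s * f z := by
  simp [planSum]

variable {X : Type*} {K : ℕ} {N : Fin K → ℕ}

/-- The mass that the plan `μ` assigns to the `j`-th atom of the `k`-th reference distribution. -/
noncomputable def planMarginal (k : Fin K) (j : Fin (N k)) :
    ((X × (∀ k, Fin (N k))) →₀ ℝ) →ₗ[ℝ] ℝ :=
  planSum fun z => if z.2 k = j then 1 else 0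

/-- The cost of transporting the plan `μ` to the `k`-th reference distribution. -/
noncomputable def planCost (c : X → X → ℝ) (atom : ∀ k, Fin (N k) → X) (k : Fin K) :
    ((X × (∀ k, Fin (N k))) →₀ ℝ) →ₗ[ℝ] ℝ :=
  planSum fun z => c z.1 (atom k (z.2 k))

/-- The expected loss under the plan `μ`. -/
noncomputable def planValue (loss : X → ℝ) : ((X × (∀ k, Fin (N k))) →₀ ℝ) →ₗ[ℝ] ℝ :=
  planSum fun z => loss z.1

/-- The cone of all vectors of marginals, cost bounds and value bounds of finitely supported
nonnegative plans. -/
def planCone (c : X → X → ℝ) (loss : X → ℝ) (atom : ∀ k, Fin (N k) → X) :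
    Set (((Σ k, Fin (N k)) → ℝ) × (Fin K → ℝ) × ℝ) :=
  {w | ∃ μ : (X × (∀ k, Fin (N k))) →₀ ℝ, (∀ z, 0 ≤ μ z) ∧
    (∀ s, planMarginal s.1 s.2 μ = w.1 s) ∧ (∀ k, planCost c atom k μ ≤ w.2.1 k) ∧
    w.2.2 ≤ planValue loss μ}

variable {c : X → X → ℝ} {loss : X → ℝ} {atom : ∀ k, Fin (N k) → X}

theorem add_mem_planCone {v w : ((Σ k, Fin (N k)) → ℝ) × (Fin K → ℝ) × ℝ}
    (hv : v ∈ planCone c loss atom) (hw : w ∈ planCone c loss atom) :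
    v + w ∈ planCone c loss atom := by
  obtain ⟨μ, h1, h2, h3, h4⟩ := hv
  obtain ⟨ν, g1, g2, g3, g4⟩ := hw
  refine ⟨μ + ν, fun z => add_nonneg (h1 z) (g1 z), fun s => ?_, fun k => ?_, ?_⟩
  · simp [h2, g2]
  · simpa using add_le_add (h3 k) (g3 k)
  · simpa using add_le_add h4 g4

theorem smul_mem_planCone {w : ((Σ k, Fin (N k)) → ℝ) × (Fin K → ℝ) × ℝ}
    (hw : w ∈ planCone c loss atom) {t : ℝ} (ht : 0 ≤ t) : t • w ∈ planCone c loss atom := by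
  obtain ⟨ν, g1, g2, g3, g4⟩ := hw
  refine ⟨t • ν, fun z => mul_nonneg ht (g1 z), fun s => ?_, fun k => ?_, ?_⟩
  · simp [g2]
  · simpa using mul_le_mul_of_nonneg_left (g3 k) ht
  · simpa using mul_le_mul_of_nonneg_left g4 ht

theorem mem_planCone_of_nonneg {e : Fin K → ℝ} (he : ∀ k, 0 ≤ e k) {v : ℝ} (hv : v ≤ 0) :
    ((0, e, v) : ((Σ k, Fin (N k)) → ℝ) × (Fin K → ℝ) × ℝ) ∈ planCone c loss atom :=
  ⟨0, fun _ => le_rfl, fun _ => by simp, fun k => by simpa using he k, by simpa using hv⟩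

theorem point_mem_planCone (x : X) (α : ∀ k, Fin (N k)) :
    ((fun s => if α s.1 = s.2 then 1 else 0, fun k => c x (atom k (α k)), loss x) :
      ((Σ k, Fin (N k)) → ℝ) × (Fin K → ℝ) × ℝ) ∈ planCone c loss atom := by
  classical
  refine ⟨Finsupp.single (x, α) 1, fun z => ?_, fun s => ?_, fun k => ?_, ?_⟩
  · rw [Finsupp.single_apply]
    split_ifs <;> norm_num
  · simp [planMarginal]
  · simp [planCost]
  · simp [planValue]

theorem convex_planCone : Convex ℝ (planCone c loss atom) := fun _ hv _ hw _ _ ha hb _ =>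
  add_mem_planCone (smul_mem_planCone hv ha) (smul_mem_planCone hw hb)

/-- Each linear functional on the space of the plan cone is given by coefficients. -/
theorem exists_coeff (f : (((Σ k, Fin (N k)) → ℝ) × (Fin K → ℝ) × ℝ) →ₗ[ℝ] ℝ) :
    ∃ (Γ : ∀ k, Fin (N k) → ℝ) (lam : Fin K → ℝ) (τ : ℝ), ∀ q e v,
      f (q, e, v) = ∑ k, ∑ j, q ⟨k, j⟩ * Γ k j + ∑ k, e k * lam k + v * τ := by
  classical
  refine ⟨fun k j => f (Pi.single ⟨k, j⟩ 1, 0, 0), fun k => f (0, Pi.single k 1, 0), f (0, 0, 1),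
    fun q e v => ?_⟩
  have h1 : f (q, 0, 0) = ∑ k, ∑ j, q ⟨k, j⟩ * f (Pi.single ⟨k, j⟩ 1, 0, 0) := by
    have := LinearMap.pi_apply_eq_sum_univ (f ∘ₗ LinearMap.inl ℝ _ _) q
    simp only [LinearMap.comp_apply, LinearMap.inl_apply, smul_eq_mul] at this
    rw [← Finset.univ_sigma_univ, Finset.sum_sigma] at this
    refine this.trans (Finset.sum_congr rfl fun k _ => Finset.sum_congr rfl fun j _ => ?_)
    congr 3
    ext i
    simp [Pi.single_apply, eq_comm]
  have h2 : f (0, e, 0) = ∑ k, e k * f (0, Pi.single k 1, 0) := by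
    have := LinearMap.pi_apply_eq_sum_univ
      (f ∘ₗ LinearMap.inr ℝ _ _ ∘ₗ LinearMap.inl ℝ _ _) e
    simp only [LinearMap.comp_apply, LinearMap.inl_apply, LinearMap.inr_apply,
      smul_eq_mul] at this
    refine this.trans (Finset.sum_congr rfl fun k _ => ?_)
    congr 4
    ext i
    simp [Pi.single_apply, eq_comm]
  have h3 : f (0, 0, v) = v * f (0, 0, 1) := by
    rw [← smul_eq_mul, ← map_smul]
    simp
  rw [← h1, ← h2, ← h3, ← map_add, ← map_add]
  simp

/-- A functional separating the point from the closed cone has coefficients `(Γ, lam, τ)` that form,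
up to scaling, a dual point with value below `v₀` or a direction along which the dual objective
decreases without bound. -/
theorem mem_closure_planCone {prob : ∀ k, Fin (N k) → ℝ} {ε : Fin K → ℝ≥0}
    (hfeas : (dualFeasible c loss atom).Nonempty) {v₀ : ℝ}
    (hv₀ : (v₀ : EReal) < dualValue c loss prob atom ε) :
    ((fun s => prob s.1 s.2, fun k => (ε k : ℝ), v₀) :
      ((Σ k, Fin (N k)) → ℝ) × (Fin K → ℝ) × ℝ) ∈ closure (planCone c loss atom) := by
  classical
  by_contra hnot
  obtain ⟨f, u, hfu, hu⟩ := geometric_hahn_banach_point_closed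
    (convex_planCone (c := c) (loss := loss) (atom := atom)).closure isClosed_closure hnot
  have h0 : u < 0 := by
    have := hu _ (subset_closure (mem_planCone_of_nonneg (e := 0) (fun _ => le_rfl) le_rfl))
    rwa [Prod.mk_zero_zero, Prod.mk_zero_zero, map_zero] at this
  -- On a cone, a negative value could be rescaled to equal `u` exactly.
  have hpos : ∀ w ∈ planCone c loss atom, 0 ≤ f w := by
    intro w hw
    by_contra! hneg
    have h1 := hu _ (subset_closure (smul_mem_planCone hw (div_nonneg_of_nonpos h0.le hneg.le)))
    rw [map_smul, smul_eq_mul, div_mul_cancel₀ _ hneg.ne] at h1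
    exact lt_irrefl _ h1
  obtain ⟨Γ, lam, τ, hf⟩ := exists_coeff f.toLinearMap
  simp only [ContinuousLinearMap.coe_coe] at hf
  have hlam : ∀ k, 0 ≤ lam k := by
    intro k
    have := hpos _ (mem_planCone_of_nonneg (e := Pi.single k 1) (fun i => by
      rw [Pi.single_apply]; split_ifs <;> norm_num) le_rfl)
    simpa [hf, Pi.single_apply] using this
  have hτ : τ ≤ 0 := by
    have := hpos _ (mem_planCone_of_nonneg (e := 0) (fun i => le_rfl) (v := -1) (by norm_num))
    simpa [hf] using this
  have hpt : ∀ (x : X) (α : ∀ k, Fin (N k)), 0 ≤ ∑ k, Γ k (α k) + ∑ k, c x (atom k (α k)) * lam k + loss x * τ := by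
    intro x α
    have := hpos _ (point_mem_planCone x α)
    simpa [hf] using this
  have hval := hfu.trans h0
  simp only [hf] at hval
  have hdual : ∀ lam' : Fin K → ℝ, (∀ k, 0 ≤ lam' k) → ∀ γ : ∀ k, Fin (N k) → ℝ,
      (∀ (x : X) (α : ∀ k, Fin (N k)), loss x - ∑ k, lam' k * c x (atom k (α k)) ≤ ∑ k, γ k (α k)) →
      v₀ < ∑ k, (ε k : ℝ) * lam' k + ∑ k, ∑ j, prob k j * γ k j := by
    intro lam' hl γ hγ
    refine EReal.coe_lt_coe_iff.1 (hv₀.trans_le (iInf₂_le (lam', γ) ⟨hl, fun α => ?_⟩))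
    exact iSup_le fun x => EReal.coe_le_coe_iff.2 (hγ x α)
  rcases hτ.lt_or_eq with hτ | hτ
  -- Dividing by `-τ` normalizes the coefficient of the loss and gives a dual point with value below
  -- `v₀`.
  · have ht : 0 < (-τ)⁻¹ := by
      rw [inv_pos]
      linarith
    have hτ1 : (-τ)⁻¹ * τ = -1 := by
      rw [inv_neg, neg_mul, inv_mul_cancel₀ hτ.ne]
    have h1 := hdual (fun k => (-τ)⁻¹ * lam k) (fun k => mul_nonneg ht.le (hlam k))
      (fun k j => (-τ)⁻¹ * Γ k j) (fun x α => by
        have := mul_nonneg ht.le (hpt x α)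
        have h2 : ∑ k, (-τ)⁻¹ * lam k * c x (atom k (α k)) =
            (-τ)⁻¹ * ∑ k, c x (atom k (α k)) * lam k := by
          rw [Finset.mul_sum]
          exact Finset.sum_congr rfl fun k _ => by ring
        rw [h2, ← Finset.mul_sum]
        linear_combination this + loss x * hτ1)
    have h3 : ∑ k, (ε k : ℝ) * ((-τ)⁻¹ * lam k) = (-τ)⁻¹ * ∑ k, (ε k : ℝ) * lam k := by
      rw [Finset.mul_sum]
      exact Finset.sum_congr rfl fun k _ => by ring
    have h4 : ∑ k, ∑ j, prob k j * ((-τ)⁻¹ * Γ k j) = (-τ)⁻¹ * ∑ k, ∑ j, prob k j * Γ k j := by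
      simp only [Finset.mul_sum]
      exact Finset.sum_congr rfl fun k _ => Finset.sum_congr rfl fun j _ => by ring
    rw [h3, h4] at h1
    have h5 := mul_neg_of_pos_of_neg ht hval
    have h6 : (-τ)⁻¹ * (v₀ * τ) = -v₀ := by linear_combination v₀ * hτ1
    rw [mul_add, mul_add, h6] at h5
    linarith
  -- With `τ = 0` the pair `(lam, Γ)` is a recession direction of the dual feasible set with
  -- negative objective `y`; following it far enough from a feasible point passes below `v₀`.
  · subst hτ
    obtain ⟨⟨lam₁, γ₁⟩, hl₁, hγ₁⟩ := hfeas
    set y := ∑ k, ∑ j, prob k j * Γ k j + ∑ k, (ε k : ℝ) * lam k with hy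
    set y₁ := ∑ k, (ε k : ℝ) * lam₁ k + ∑ k, ∑ j, prob k j * γ₁ k j with hy₁
    have hyneg : y < 0 := by simpa using hval
    obtain ⟨s, hs0, hs⟩ : ∃ s : ℝ, 0 ≤ s ∧ y₁ + s * y ≤ v₀ := by
      refine ⟨max 0 ((v₀ - y₁) / y), le_max_left _ _, ?_⟩
      have h1 := mul_le_mul_of_nonpos_right (le_max_right 0 ((v₀ - y₁) / y)) hyneg.le
      rw [div_mul_cancel₀ _ hyneg.ne] at h1
      linarith
    have h1 := hdual (fun k => lam₁ k + s * lam k)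
      (fun k => add_nonneg (hl₁ k) (mul_nonneg hs0 (hlam k)))
      (fun k j => γ₁ k j + s * Γ k j) (fun x α => by
        have h2 := EReal.coe_le_coe_iff.1 ((le_iSup _ x).trans (hγ₁ α))
        have h3 := mul_nonneg hs0 (hpt x α)
        have h4 : ∑ k, (lam₁ k + s * lam k) * c x (atom k (α k)) =
            ∑ k, lam₁ k * c x (atom k (α k)) + s * ∑ k, c x (atom k (α k)) * lam k := by
          rw [Finset.mul_sum, ← Finset.sum_add_distrib]
          exact Finset.sum_congr rfl fun k _ => by ring
        rw [h4, Finset.sum_add_distrib, ← Finset.mul_sum]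
        simp only at h2
        linarith)
    have h2 : ∑ k, (ε k : ℝ) * (lam₁ k + s * lam k) + ∑ k, ∑ j, prob k j * (γ₁ k j + s * Γ k j) =
        y₁ + s * y := by
      simp only [hy, hy₁, mul_add, Finset.mul_sum, Finset.sum_add_distrib, mul_left_comm s]
      ring
    linarith

end Plans

/-! ### Restoring exact marginals. -/

section Repair

variable {X : Type*} {K : ℕ} {N : Fin K → ℕ}

/-- Nonnegative vectors with equal totals are the marginals of a nonnegative function. -/
theorem exists_weights_of_marginals (hK : 0 < K) {r : ∀ k, Fin (N k) → ℝ}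
    (hr : ∀ k j, 0 ≤ r k j) {R : ℝ} (hR : ∀ k, ∑ j, r k j = R) :
    ∃ w : (∀ k, Fin (N k)) → ℝ, (∀ α, 0 ≤ w α) ∧
      (∀ k j, ∑ α, w α * (if α k = j then 1 else 0) = r k j) ∧ ∑ α, w α = R := by
  classical
  obtain ⟨w, hw, hm⟩ : ∃ w : (∀ k, Fin (N k)) → ℝ, (∀ α, 0 ≤ w α) ∧
      ∀ k j, ∑ α, w α * (if α k = j then 1 else 0) = r k j := by
    by_cases hR0 : R = 0
    · refine ⟨0, fun _ => le_rfl, fun k j => ?_⟩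
      have h1 := (Finset.sum_eq_zero_iff_of_nonneg fun j _ => hr k j).1 ((hR k).trans hR0) j
        (Finset.mem_univ j)
      simp [h1]
    -- Product weights: fixing coordinate `k` and summing out the others yields a factor `R` for
    -- each of the `K - 1` remaining coordinates.
    · refine ⟨fun α => (R ^ (K - 1))⁻¹ * ∏ k, r k (α k), fun α => ?_, fun k j => ?_⟩
      · have : 0 ≤ R := (Finset.sum_nonneg fun j _ => hr ⟨0, hK⟩ j).trans_eq (hR _)
        exact mul_nonneg (by positivity) (Finset.prod_nonneg fun k _ => hr k _)
      · have h1 : ∀ α : ∀ k, Fin (N k), (∏ i, r i (α i)) * (if α k = j then 1 else 0) =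
            ∏ i, Function.update r k (fun l => if l = j then r k j else 0) i (α i) := by
          intro α
          rw [← Finset.mul_prod_erase _ _ (Finset.mem_univ k),
            ← Finset.mul_prod_erase _ (fun i => Function.update r k _ i (α i)) (Finset.mem_univ k)]
          have h2 : ∏ i ∈ Finset.univ.erase k, Function.update r k
              (fun l => if l = j then r k j else 0) i (α i) =
              ∏ i ∈ Finset.univ.erase k, r i (α i) :=
            Finset.prod_congr rfl fun i hi => by
              rw [Function.update_of_ne (Finset.ne_of_mem_erase hi)]
          rw [h2, Function.update_self]
          split_ifs with h
          · rw [h]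
            ring
          · ring
        simp only [mul_assoc, h1]
        rw [← Finset.mul_sum, ← Fintype.piFinset_univ, ← Finset.prod_univ_sum,
          ← Finset.mul_prod_erase _ _ (Finset.mem_univ k)]
        have h3 : ∏ i ∈ Finset.univ.erase k, ∑ l, Function.update r k
            (fun l => if l = j then r k j else 0) i l = R ^ (K - 1) := by
          rw [Finset.prod_congr rfl (g := fun _ => R) fun i hi => by
            rw [Function.update_of_ne (Finset.ne_of_mem_erase hi), hR]]
          simp [Finset.card_erase_of_mem]
        rw [h3, Function.update_self]
        simp only [Finset.sum_ite_eq', Finset.mem_univ, if_true]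
        field_simp
  refine ⟨w, hw, hm, ?_⟩
  rw [← hR ⟨0, hK⟩, Finset.sum_congr rfl fun j _ => (hm ⟨0, hK⟩ j).symm, Finset.sum_comm]
  simp

/-- All mass sits at the single point `x`, so integrals are controlled by the total mass `R`. -/
theorem exists_plan_of_marginals (hK : 0 < K) (x : X) {r : ∀ k, Fin (N k) → ℝ}
    (hr : ∀ k j, 0 ≤ r k j) {R : ℝ} (hR : ∀ k, ∑ j, r k j = R) :
    ∃ ν : (X × (∀ k, Fin (N k))) →₀ ℝ, (∀ z, 0 ≤ ν z) ∧ (∀ k j, planMarginal k j ν = r k j) ∧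
      ∀ (f : X × (∀ k, Fin (N k)) → ℝ) (M : ℝ), (∀ α, f (x, α) ≤ M) → planSum f ν ≤ R * M := by
  classical
  obtain ⟨w, hw, hm, hsum⟩ := exists_weights_of_marginals hK hr hR
  have hp : ∀ f : X × (∀ k, Fin (N k)) → ℝ,
      planSum f (∑ α, Finsupp.single (x, α) (w α)) = ∑ α, w α * f (x, α) := by
    intro f
    rw [map_sum]
    simp
  refine ⟨∑ α, Finsupp.single (x, α) (w α), fun z => ?_, fun k j => ?_, fun f M hf => ?_⟩
  · rw [Finsupp.finsetSum_apply]
    refine Finset.sum_nonneg fun α _ => ?_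
    rw [Finsupp.single_apply]
    split_ifs
    exacts [hw α, le_rfl]
  · rw [planMarginal, hp, ← hm k j]
  · rw [hp, ← hsum, Finset.sum_mul]
    exact Finset.sum_le_sum fun α _ => mul_le_mul_of_nonneg_left (hf α) (hw α)

theorem sum_planMarginal (k : Fin K) (μ : (X × (∀ k, Fin (N k))) →₀ ℝ) :
    ∑ j, planMarginal k j μ = ∑ z ∈ μ.support, μ z := by
  simp only [planMarginal, planSum_apply]
  rw [Finset.sum_comm]
  simp

/-- Approximate feasibility of a plan can be turned into feasibility with exact marginals, at an
arbitrarily small loss in the cost and the value. -/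
theorem exists_plan_of_mem_closure {c : X → X → ℝ} {loss : X → ℝ} {prob : ∀ k, Fin (N k) → ℝ}
    {atom : ∀ k, Fin (N k) → X} (hc0 : ∀ x y, 0 ≤ c x y) (hK : 0 < K) (x : X)
    (hprob : ∀ k j, 0 < prob k j) (hsum : ∀ k, ∑ j, prob k j = 1) {e : Fin K → ℝ}
    (he : ∀ k, 0 ≤ e k) {v : ℝ}
    (h : ((fun s => prob s.1 s.2, e, v) : ((Σ k, Fin (N k)) → ℝ) × (Fin K → ℝ) × ℝ) ∈
      closure (planCone c loss atom)) {δ : ℝ} (hδ : 0 < δ) :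
    ∃ μ : (X × (∀ k, Fin (N k))) →₀ ℝ, (∀ z, 0 ≤ μ z) ∧
      (∀ k j, planMarginal k j μ = prob k j) ∧ (∀ k, planCost c atom k μ ≤ e k + δ) ∧
      v - δ ≤ planValue loss μ := by
  classical
  set M : ℝ := ∑ k, ∑ j, c x (atom k j) + |loss x| with hM
  have hsum0 : ∀ k, 0 ≤ ∑ j, c x (atom k j) := fun k => Finset.sum_nonneg fun j _ => hc0 _ _
  have hcM : ∀ k j, c x (atom k j) ≤ M := by
    intro k j
    have h1 := Finset.single_le_sum (f := fun j => c x (atom k j)) (fun j _ => hc0 _ _)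
      (Finset.mem_univ j)
    have h2 := Finset.single_le_sum (fun k _ => hsum0 k) (Finset.mem_univ k)
    have h3 := abs_nonneg (loss x)
    linarith
  have hlM : -loss x ≤ M := by
    have h1 := neg_le_abs (loss x)
    have h2 := Finset.sum_nonneg fun k (_ : k ∈ Finset.univ) => hsum0 k
    linarith
  have hM0 : 0 ≤ M := add_nonneg (Finset.sum_nonneg fun k _ => hsum0 k) (abs_nonneg _)
  -- The budget `δ` pays `η` for the closure approximation, `2 * η * M` for the added mass and `η *
  -- |v|` for rescaling the value.
  set η : ℝ := δ / (1 + 2 * M + |v|) with hη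
  have hden : 0 < 1 + 2 * M + |v| := by positivity
  have hη0 : 0 < η := by positivity
  have hηδ : η * (1 + 2 * M + |v|) = δ := div_mul_cancel₀ _ hden.ne'
  have hopen : IsOpen {w : ((Σ k, Fin (N k)) → ℝ) × (Fin K → ℝ) × ℝ |
      (∀ s, w.1 s < (1 + η) * prob s.1 s.2 ∧ (1 - η) * prob s.1 s.2 < w.1 s) ∧
      (∀ k, w.2.1 k < e k + η) ∧ v - η < w.2.2} := by
    simp only [Set.ofPred_and, Set.ofPred_forall]
    refine (isOpen_iInter_of_finite fun s => ?_).inter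
      ((isOpen_iInter_of_finite fun k => ?_).inter ?_)
    · exact (isOpen_lt (by fun_prop) (by fun_prop)).inter (isOpen_lt (by fun_prop) (by fun_prop))
    · exact isOpen_lt (by fun_prop) (by fun_prop)
    · exact isOpen_lt (by fun_prop) (by fun_prop)
  obtain ⟨w, ⟨hw1, hw2, hw3⟩, μ, hμ0, hμ1, hμ2, hμ3⟩ := mem_closure_iff.1 h _ hopen
    ⟨fun s => ⟨by nlinarith [hprob s.1 s.2], by nlinarith [hprob s.1 s.2]⟩,
      fun k => by simpa using hη0, by simpa using hη0⟩
  -- Shrinking by `a` brings every marginal below `prob`; the deficit is nonnegative and is filled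
  -- by mass at `x`.
  set a : ℝ := (1 + η)⁻¹ with ha
  have ha0 : 0 < a := by positivity
  have ha1 : a * (1 + η) = 1 := inv_mul_cancel₀ (by positivity)
  have haη : 1 - a ≤ η := by nlinarith
  have ha1' : a ≤ 1 := by nlinarith
  have hmass : 1 - η ≤ ∑ z ∈ μ.support, μ z := by
    rw [← sum_planMarginal ⟨0, hK⟩ μ]
    calc 1 - η = ∑ j, (1 - η) * prob ⟨0, hK⟩ j := by rw [← Finset.mul_sum, hsum, mul_one]
      _ ≤ _ := Finset.sum_le_sum fun j _ => by
        rw [hμ1 ⟨⟨0, hK⟩, j⟩]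
        exact (hw1 ⟨⟨0, hK⟩, j⟩).2.le
  obtain ⟨ν, hν0, hν1, hν2⟩ := exists_plan_of_marginals hK x
    (r := fun k j => prob k j - a * planMarginal k j μ)
    (fun k j => by
      have h1 := mul_le_mul_of_nonneg_left (hw1 ⟨k, j⟩).1.le ha0.le
      rw [← mul_assoc, ha1, one_mul, ← hμ1 ⟨k, j⟩] at h1
      exact sub_nonneg.2 h1)
    (R := 1 - a * ∑ z ∈ μ.support, μ z)
    (fun k => by rw [Finset.sum_sub_distrib, hsum, ← Finset.mul_sum, sum_planMarginal])
  have hR : (1 - a * ∑ z ∈ μ.support, μ z) * M ≤ 2 * η * M := by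
    refine mul_le_mul_of_nonneg_right ?_ hM0
    nlinarith
  refine ⟨a • μ + ν, fun z => add_nonneg (mul_nonneg ha0.le (hμ0 z)) (hν0 z), fun k j => ?_,
    fun k => ?_, ?_⟩
  · simp [hν1]
  · have h1 := hν2 (fun z => c z.1 (atom k (z.2 k))) M fun α => hcM k _
    have h2 : a * planCost c atom k μ ≤ e k + η := by
      have h3 := (hμ2 k).trans (hw2 k).le
      have h4 := mul_le_mul_of_nonneg_left h3 ha0.le
      have h5 := mul_le_of_le_one_left (add_nonneg (he k) hη0.le) ha1'
      linarith
    have h3 : planCost c atom k (a • μ + ν) = a * planCost c atom k μ + planCost c atom k ν := by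
      simp
    have h4 : planCost c atom k ν ≤ (1 - a * ∑ z ∈ μ.support, μ z) * M := h1
    have h5 := mul_nonneg hη0.le (abs_nonneg v)
    rw [h3]
    linarith
  · have h1 := hν2 (fun z => -loss z.1) M fun α => hlM
    have h2 : planSum (fun z : X × (∀ k, Fin (N k)) => -loss z.1) ν = -planValue loss ν := by
      simp [planValue, planSum_apply]
    have h3 : planValue loss (a • μ + ν) = a * planValue loss μ + planValue loss ν := by simp
    have h4 : a * (v - η) ≤ a * planValue loss μ :=
      mul_le_mul_of_nonneg_left (hw3.le.trans hμ3) ha0.le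
    have h5 : v - η * |v| - η ≤ a * (v - η) := by
      have h7 : (1 - a) * v ≤ η * |v| :=
        (mul_le_mul_of_nonneg_left (le_abs_self v) (by linarith)).trans
          (mul_le_mul_of_nonneg_right haη (abs_nonneg v))
      nlinarith
    rw [h2] at h1
    rw [h3]
    linarith

end Repair

/-! ### From plans to distributions in the ambiguity set. -/

section PlanToMeasure

variable {X : Type*} [MeasurableSpace X] [MeasurableSingletonClass X] {K : ℕ} {N : Fin K → ℕ}

/-- The first marginal of a finitely supported plan lies in the ambiguity set. -/
theorem exists_mem_ambiguitySet_of_plan {c : X → X → ℝ} {prob : ∀ k, Fin (N k) → ℝ}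
    {atom : ∀ k, Fin (N k) → X} (hc0 : ∀ x y, 0 ≤ c x y) (hK : 0 < K)
    {Q : Fin K → ProbabilityMeasure X} (hprob : ∀ k j, 0 ≤ prob k j)
    (hQ : ∀ k, (Q k : Measure X) =
      ∑ j, ENNReal.ofReal (prob k j) • Measure.dirac (atom k j))
    {ε : Fin K → ℝ≥0} {μ : (X × (∀ k, Fin (N k))) →₀ ℝ} (hμ : ∀ z, 0 ≤ μ z)
    (hm : ∀ k j, planMarginal k j μ = prob k j) (hcost : ∀ k, planCost c atom k μ ≤ ε k) :
    ∃ P ∈ ambiguitySet c Q ε, ∀ loss : X → ℝ, expectation P loss = (planValue loss μ : EReal) := by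
  classical
  have hone : ∑ z ∈ μ.support, μ z = 1 := by
    rw [← sum_planMarginal ⟨0, hK⟩ μ]
    simp only [hm]
    exact sum_eq_one_of_discrete (Q ⟨0, hK⟩) (hprob _) (hQ _)
  have hprobmeas : ∀ {Y : Type _} [MeasurableSpace Y] (g : X × (∀ k, Fin (N k)) → Y),
      IsProbabilityMeasure (∑ z ∈ μ.support, ENNReal.ofReal (μ z) • Measure.dirac (g z)) := by
    intro Y _ g
    refine ⟨?_⟩
    simp only [Measure.coe_finsetSum, Finset.sum_apply, Measure.smul_apply, measure_univ,
      smul_eq_mul, mul_one]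
    rw [← ENNReal.ofReal_sum_of_nonneg fun z _ => hμ z, hone, ENNReal.ofReal_one]
  let P : ProbabilityMeasure X :=
    ⟨∑ z ∈ μ.support, ENNReal.ofReal (μ z) • Measure.dirac z.1, hprobmeas _⟩
  have hP : (P : Measure X) = ∑ z ∈ μ.support, ENNReal.ofReal (μ z) • Measure.dirac z.1 := rfl
  refine ⟨P, Set.mem_iInter.2 fun k => ?_, fun loss => ?_⟩
  · let π : ProbabilityMeasure (X × X) :=
      ⟨∑ z ∈ μ.support, ENNReal.ofReal (μ z) • Measure.dirac (z.1, atom k (z.2 k)), hprobmeas _⟩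
    have hπ : (π : Measure (X × X)) =
      ∑ z ∈ μ.support, ENNReal.ofReal (μ z) • Measure.dirac (z.1, atom k (z.2 k)) := rfl
    have hmem : π ∈ transportPlans P (Q k) := by
      constructor
      · ext s hs
        rw [Measure.map_apply measurable_fst hs, hπ, hP]
        simp only [Measure.coe_finsetSum, Finset.sum_apply, Measure.smul_apply, smul_eq_mul,
          Measure.dirac_apply' _ hs, Measure.dirac_apply' _ (measurable_fst hs)]
        rfl
      · ext s hs
        rw [Measure.map_apply measurable_snd hs, hπ, hQ]
        simp only [Measure.coe_finsetSum, Finset.sum_apply, Measure.smul_apply, smul_eq_mul,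
          Measure.dirac_apply' _ hs, Measure.dirac_apply' _ (measurable_snd hs)]
        -- The marginal condition, read in `ℝ≥0∞`, regroups the mass of the plan by its target atom.
        have : ∀ j, ENNReal.ofReal (prob k j) =
            ∑ z ∈ μ.support, if z.2 k = j then ENNReal.ofReal (μ z) else 0 := by
          intro j
          rw [← hm k j, planMarginal, planSum_apply, ENNReal.ofReal_sum_of_nonneg]
          · refine Finset.sum_congr rfl fun z _ => ?_
            split_ifs <;> simp
          · intro z _
            split_ifs
            · simpa using hμ z
            · simp
        simp only [this, Finset.sum_mul]
        rw [Finset.sum_comm]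
        refine Finset.sum_congr rfl fun z _ => ?_
        rw [Finset.sum_eq_single (z.2 k) (fun j _ hj => by simp [hj.symm]) (by simp), if_pos rfl]
        rfl
    change otCost c P (Q k) ≤ ε k
    refine (iInf₂_le π hmem).trans ?_
    rw [hπ, lintegral_finsetSum_measure]
    simp only [lintegral_smul_measure, lintegral_dirac, smul_eq_mul]
    simp only [← ENNReal.ofReal_mul (hμ _)]
    rw [← ENNReal.ofReal_sum_of_nonneg fun z _ => mul_nonneg (hμ z) (hc0 _ _),
      ← ENNReal.ofReal_coe_nnreal]
    refine ENNReal.ofReal_le_ofReal (le_trans (le_of_eq ?_) (hcost k))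
    rw [planCost, planSum_apply]
  · have hi : ∀ z ∈ μ.support,
        Integrable loss (ENNReal.ofReal (μ z) • Measure.dirac z.1) := fun z _ =>
      (integrable_dirac (by simp)).smul_measure ENNReal.ofReal_ne_top
    have hint : Integrable loss (P : Measure X) := integrable_finsetSum_measure.2 hi
    rw [expectation_eq_integral P hint, hP, integral_finsetSum_measure hi, planValue,
      planSum_apply]
    congr 1
    refine Finset.sum_congr rfl fun z _ => ?_
    rw [integral_smul_measure, integral_dirac, ENNReal.toReal_ofReal (hμ z), smul_eq_mul]

end PlanToMeasure

/-! ### Strong duality away from the boundary of the feasible radii. -/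

section StrongDuality

open Filter Topology

theorem mem_closure_of_forall_add_mem {S : Set (Fin K → ℝ≥0)} {ε : Fin K → ℝ≥0}
    (h : ∀ δ : ℝ≥0, 0 < δ → (fun k => ε k + δ) ∈ S) : ε ∈ closure S := by
  have hcont : Continuous fun δ : ℝ≥0 => (fun k => ε k + δ : Fin K → ℝ≥0) := by fun_prop
  have ht : Tendsto (fun δ : ℝ≥0 => (fun k => ε k + δ : Fin K → ℝ≥0)) (𝓝[>] 0) (𝓝 ε) := by
    have := hcont.tendsto 0
    simp only [add_zero] at this
    exact this.mono_left nhdsWithin_le_nhds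
  exact mem_closure_of_tendsto ht (eventually_mem_nhdsWithin.mono fun δ hδ => h δ hδ)

theorem exists_sub_mem_of_mem_interior {S : Set (Fin K → ℝ≥0)} {ε : Fin K → ℝ≥0}
    (h : ε ∈ interior S) (hε : ∀ k, 0 < ε k) :
    ∃ s : ℝ≥0, 0 < s ∧ (∀ k, s < ε k) ∧ (fun k => ε k - s) ∈ S := by
  have hcont : Continuous fun s : ℝ≥0 => (fun k => ε k - s : Fin K → ℝ≥0) := by fun_prop
  have ht : Tendsto (fun s : ℝ≥0 => (fun k => ε k - s : Fin K → ℝ≥0)) (𝓝[>] 0) (𝓝 ε) := by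
    have := hcont.tendsto 0
    simp only [tsub_zero] at this
    exact this.mono_left nhdsWithin_le_nhds
  have h1 : ∀ᶠ s : ℝ≥0 in 𝓝[>] 0, ∀ k, s < ε k :=
    eventually_all.2 fun k => nhdsWithin_le_nhds (eventually_lt_nhds (hε k))
  obtain ⟨s, ⟨hs0, hs1⟩, hs2⟩ := ((eventually_mem_nhdsWithin.and h1).and
    (ht.eventually (mem_interior_iff_mem_nhds.1 h))).exists
  exact ⟨s, hs0, hs1, hs2⟩

variable {X : Type*} [TopologicalSpace X]
  {c ρ : X → X → ℝ} {p p' : ℕ} {loss : X → ℝ} {K : ℕ} {N : Fin K → ℕ}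
  {prob : ∀ k, Fin (N k) → ℝ} {atom : ∀ k, Fin (N k) → X}

/-- Every value below the dual value is almost attained by finitely supported plans with exact
marginals and almost feasible costs. -/
theorem IsTransportCost.exists_plan (hc : IsTransportCost c ρ p)
    (hloss : UpperSemicontinuous loss) (hgrowth : HasGrowth ρ loss p') (hp : p' ≤ p)
    (hK : 0 < K) (hprob : ∀ k j, 0 < prob k j) (hsum : ∀ k, ∑ j, prob k j = 1)
    {ε : Fin K → ℝ≥0} {v : ℝ} (hv : (v : EReal) < dualValue c loss prob atom ε)
    {δ : ℝ} (hδ : 0 < δ) :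
    ∃ μ : (X × (∀ k, Fin (N k))) →₀ ℝ, (∀ z, 0 ≤ μ z) ∧
      (∀ k j, planMarginal k j μ = prob k j) ∧ (∀ k, planCost c atom k μ ≤ ε k + δ) ∧
      v - δ ≤ planValue loss μ := by
  obtain ⟨x, -⟩ := id hgrowth
  refine exists_plan_of_mem_closure hc.nonneg hK x hprob hsum (fun k => (ε k).2) ?_ hδ
  refine mem_closure_planCone ?_ hv
  obtain ⟨L, hL, h⟩ := hc.exists_penalized_le hloss hgrowth hp (atom ⟨0, hK⟩) one_pos
  have hlt : dualValue c loss prob atom ε < ⊤ :=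
    (dualValue_le_of_penalized_le ⟨0, hK⟩ hL h ε).trans_lt (EReal.coe_lt_top _)
  obtain ⟨w, hw⟩ := iInf_lt_iff.1 hlt
  obtain ⟨hw, -⟩ := iInf_lt_iff.1 hw
  exact ⟨w, hw⟩

variable [T1Space X] [MeasurableSpace X] [BorelSpace X]
  {Q : Fin K → ProbabilityMeasure X}

/-- The dual problem is unbounded whenever the primal problem is stably infeasible. -/
theorem IsTransportCost.dualValue_eq_bot (hc : IsTransportCost c ρ p)
    (hloss : UpperSemicontinuous loss) (hgrowth : HasGrowth ρ loss p') (hp : p' ≤ p)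
    (hK : 0 < K) (hprob : ∀ k j, 0 < prob k j)
    (hQ : ∀ k, (Q k : Measure X) =
      ∑ j, ENNReal.ofReal (prob k j) • Measure.dirac (atom k j))
    {ε : Fin K → ℝ≥0} (hε : ε ∉ closure (feasibleRadii c Q)) :
    dualValue c loss prob atom ε = ⊥ := by
  by_contra hne
  -- Any real `v` below the dual value will do, since only the costs of the resulting plans matter.
  obtain ⟨v, -, hv⟩ := EReal.lt_iff_exists_real_btwn.1 (bot_lt_iff_ne_bot.2 hne)
  refine hε (mem_closure_of_forall_add_mem fun δ hδ => ?_)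
  obtain ⟨μ, hμ, hm, hcost, -⟩ := hc.exists_plan hloss hgrowth hp hK hprob
    (fun k => sum_eq_one_of_discrete (Q k) (fun j => (hprob k j).le) (hQ k)) hv
    (NNReal.coe_pos.2 hδ)
  obtain ⟨P, hP, -⟩ := exists_mem_ambiguitySet_of_plan hc.nonneg hK
    (fun k j => (hprob k j).le) hQ (ε := fun k => ε k + δ) hμ hm
    (fun k => (hcost k).trans_eq (NNReal.coe_add _ _).symm)
  exact ⟨P, hP⟩

variable [SecondCountableTopology X]

theorem IsTransportCost.dualValue_le_primalValue_of_radius_eq_zero [HasOuterApproxClosed X]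
    (hc : IsTransportCost c ρ p)
    (hloss : UpperSemicontinuous loss) (hgrowth : HasGrowth ρ loss p') (hp : p' ≤ p)
    (hprob : ∀ k j, 0 < prob k j)
    (hQ : ∀ k, (Q k : Measure X) =
      ∑ j, ENNReal.ofReal (prob k j) • Measure.dirac (atom k j))
    {ε : Fin K → ℝ≥0} (hε : ε ∈ feasibleRadii c Q) {k : Fin K} (hk : ε k = 0) :
    dualValue c loss prob atom ε ≤ primalValue c loss Q ε := by
  obtain ⟨P, hP⟩ := hε
  have hw := fun j => (hprob k j).le
  have hPk : P ∈ otBall c (Q k) 0 := by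
    have := Set.mem_iInter.1 hP k
    rwa [hk] at this
  have hPQ : P = Q k := eq_of_mem_otBall_zero hc hc.lsc.measurable hw (hQ k) hPk
  obtain ⟨hint, hval⟩ := integral_discrete (Q k) hw (hQ k) loss
  refine (hc.dualValue_le_sum hloss hgrowth hp (sum_eq_one_of_discrete _ hw (hQ k)) hk).trans ?_
  rw [← hval, ← expectation_eq_integral _ hint, ← hPQ]
  exact le_iSup₂_of_le P hP le_rfl

/-- A Slater argument: feasibility at the smaller radii `ε k - s` produces a finitely supported plan
`μ₀` with slack `s / 2` in every cost. -/
theorem IsTransportCost.dualValue_le_primalValue_of_mem_interior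
    (hc : IsTransportCost c ρ p)
    (hloss : UpperSemicontinuous loss) (hgrowth : HasGrowth ρ loss p') (hp : p' ≤ p)
    (hK : 0 < K) (hprob : ∀ k j, 0 < prob k j)
    (hQ : ∀ k, (Q k : Measure X) =
      ∑ j, ENNReal.ofReal (prob k j) • Measure.dirac (atom k j))
    {ε : Fin K → ℝ≥0} (hε : ε ∈ interior (feasibleRadii c Q)) (hpos : ∀ k, 0 < ε k) :
    dualValue c loss prob atom ε ≤ primalValue c loss Q ε := by
  have hprob' := fun k j => (hprob k j).le
  have hsum := fun k => sum_eq_one_of_discrete (Q k) (hprob' k) (hQ k)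
  obtain ⟨s, hs, hsε, P, hP⟩ := exists_sub_mem_of_mem_interior hε hpos
  have hgrowth0 : HasGrowth ρ (fun _ => (0 : ℝ)) 0 := by
    obtain ⟨x, -⟩ := id hgrowth
    exact ⟨x, 1, one_pos, fun _ => by norm_num⟩
  -- `P` need not be finitely supported. By weak duality with zero loss its existence keeps the dual
  -- value nonnegative, which is turned back into a plan; `-1` is an arbitrary negative number.
  have hzero : ((-1 : ℝ) : EReal) < dualValue c (fun _ => 0) prob atom fun k => ε k - s := by
    have h1 := primalValue_le_dualValue hc.nonneg hc.lsc.measurable hprob' hQ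
      (loss := fun _ => 0) measurable_const (fun k => ε k - s)
    have h2 : expectation P (fun _ => 0) ≤ primalValue c (fun _ => 0) Q fun k => ε k - s :=
      le_iSup₂_of_le P hP le_rfl
    rw [expectation_eq_integral P (integrable_const 0)] at h2
    refine lt_of_lt_of_le (EReal.coe_lt_coe_iff.2 ?_) (h2.trans h1)
    simp
  have hs' : (0 : ℝ) < s := hs
  obtain ⟨μ₀, hμ₀, hm₀, hcost₀, -⟩ := hc.exists_plan upperSemicontinuous_const hgrowth0
    (Nat.zero_le p) hK hprob hsum hzero (half_pos hs')
  have hslater : ∀ k, planCost c atom k μ₀ ≤ ε k - s / 2 := by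
    intro k
    have := hcost₀ k
    rw [NNReal.coe_sub (hsε k).le] at this
    linarith
  refine EReal.ge_of_forall_gt_iff_ge.1 fun v hv => ?_
  -- With excess `δ = t * (s / 2)` the mixture costs at most `(1 - t) * (ε k + t * (s / 2)) + t * (ε
  -- k - s / 2) = ε k - t ^ 2 * (s / 2)`. The value bound tends to `v` as `t → 0`.
  have hmix : ∀ t : ℝ, 0 < t → t < 1 → (((1 - t) * (v - t * (s / 2)) +
      t * planValue loss μ₀ : ℝ) : EReal) ≤ primalValue c loss Q ε := by
    intro t ht0 ht1
    obtain ⟨μ, hμ, hm, hcost, hval⟩ := hc.exists_plan hloss hgrowth hp hK hprob hsum hv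
      (δ := t * (s / 2)) (by positivity)
    have ht1' : 0 ≤ 1 - t := by linarith
    obtain ⟨P', hP', hexp⟩ := exists_mem_ambiguitySet_of_plan hc.nonneg hK hprob' hQ (ε := ε)
      (μ := (1 - t) • μ + t • μ₀)
      (fun z => add_nonneg (mul_nonneg ht1' (hμ z)) (mul_nonneg ht0.le (hμ₀ z)))
      (fun k j => by simp only [map_add, map_smul, hm, hm₀, smul_eq_mul]; ring) (fun k => by
        have h1 := mul_le_mul_of_nonneg_left (hcost k) ht1'
        have h2 := mul_le_mul_of_nonneg_left (hslater k) ht0.le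
        have h3 : 0 ≤ t * (t * (s / 2)) := by positivity
        simp only [map_add, map_smul, smul_eq_mul]
        linarith)
    refine le_trans (EReal.coe_le_coe_iff.2 ?_) ((hexp loss).symm.le.trans
      (le_iSup₂_of_le P' hP' le_rfl))
    have := mul_le_mul_of_nonneg_left hval ht1'
    simp only [map_add, map_smul, smul_eq_mul]
    linarith
  have hcont : Continuous fun t : ℝ =>
      (((1 - t) * (v - t * (s / 2)) + t * planValue loss μ₀ : ℝ) : EReal) :=
    continuous_coe_real_ereal.comp (by fun_prop)
  have hlim : Tendsto (fun t : ℝ =>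
      (((1 - t) * (v - t * (s / 2)) + t * planValue loss μ₀ : ℝ) : EReal)) (𝓝[>] 0)
      (𝓝 (v : EReal)) := by
    have := (hcont.tendsto 0).mono_left (nhdsWithin_le_nhds (s := Set.Ioi 0))
    simpa using this
  refine le_of_tendsto hlim ?_
  filter_upwards [Ioo_mem_nhdsGT (zero_lt_one' ℝ)] with t ht
  exact hmix t ht.1 ht.2

end StrongDuality

theorem theorem2 {n : ℕ} (Ξ : Set (EuclideanSpace ℝ (Fin n)))
    (hΞ_closed : IsClosed Ξ) (hΞ_convex : Convex ℝ Ξ)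
    (c ρ : Ξ → Ξ → ℝ) (p : ℕ) (hc : IsTransportCost c ρ p)
    {K : ℕ} (hK : 0 < K) (Q : Fin K → ProbabilityMeasure Ξ)
    (N : Fin K → ℕ) (prob : ∀ k, Fin (N k) → ℝ) (atom : ∀ k, Fin (N k) → Ξ)
    (hprob : ∀ k j, 0 < prob k j)
    (hQ : ∀ k, (Q k : Measure Ξ) =
      ∑ j, ENNReal.ofReal (prob k j) • Measure.dirac (atom k j))
    (loss : Ξ → ℝ) (hloss : UpperSemicontinuous loss)
    (p' : ℕ) (hgrowth : HasGrowth ρ loss p') (hp : p' ≤ p) :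
    (∀ ε : Fin K → ℝ≥0, primalValue c loss Q ε ≤ dualValue c loss prob atom ε) ∧
    (∀ ε : Fin K → ℝ≥0, ε ∉ frontier (feasibleRadii c Q) →
      primalValue c loss Q ε = dualValue c loss prob atom ε) := by
  have hprob' := fun k j => (hprob k j).le
  have hweak : ∀ ε : Fin K → ℝ≥0, primalValue c loss Q ε ≤ dualValue c loss prob atom ε :=
    primalValue_le_dualValue hc.nonneg hc.lsc.measurable hprob' hQ hloss.measurable
  refine ⟨hweak, fun ε hε => le_antisymm (hweak ε) ?_⟩
  by_cases hcl : ε ∈ closure (feasibleRadii c Q)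
  · have hint : ε ∈ interior (feasibleRadii c Q) := by
      by_contra hni
      exact hε ⟨hcl, hni⟩
    -- The interior is relative to the orthant, so a zero radius cannot be decreased and is treated
    -- separately.
    by_cases hpos : ∀ k, 0 < ε k
    · exact hc.dualValue_le_primalValue_of_mem_interior hloss hgrowth hp hK hprob hQ hint hpos
    · push Not at hpos
      obtain ⟨k, hk⟩ := hpos
      exact hc.dualValue_le_primalValue_of_radius_eq_zero hloss hgrowth hp hprob hQ
        (interior_subset hint) (nonpos_iff_eq_zero.1 hk)
  · rw [hc.dualValue_eq_bot hloss hgrowth hp hK hprob hQ hcl]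
    exact bot_le
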